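/- **Definitions.** All graphs are finite and simple. Let $G$ be a graph. An *activation process* in $G$ is a tuple $\mathbf A=(H;\Delta_1,\dots,\Delta_s)$, $s\ge 0$, where $H\subseteq G$ is a subgraph and each $\Delta_i\subseteq G$ is a triangle such that exactly one of the three edges of $\Delta_i$ does not belong to $H\cup\Delta_1\cup\dots\cup\Delta_{i-1}$; we say that $\Delta_i$ activates this edge. For a subgraph $G'\subseteq G$, the process activates $G'$ if $G'\subseteq H\cup\Delta_1\cup\dots\cup\Delta_s$, and $H$ activates $G'$ in $G$ if some activation process starting from $H$ does. In particular, a subgraph that activates $G$ itself contains all vertices of $G$. For an edge $e$ of $H\cup\Delta_1\cup\dots\cup\Delta_s$, let $\mathrm{con}_{\mathbf A}(e)$ be the number of indices $i$ such that $e\in E(\Delta_i)$ and $e\in E(H\cup\Delta_1\cup\dots\cup\Delta_{i-1})$. If $\mathbf A$ activates $G'$, the *excess* $\mathrm{exc}_{\mathbf A}(e)$ is $\mathrm{con}_{\mathbf A}(e)$ if $e\in E(G')\setminus E(H)$; it is $\mathrm{con}_{\mathbf A}(e)-2$ if $e\in E(H)\setminus E(G')$; and it is $\mathrm{con}_{\mathbf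 A}(e)-1$ otherwise. The process $\mathbf A$, as an activation process of $G'$, is *nice* if $\mathrm{exc}_{\mathbf A}(e)\ge 0$ for every edge $e$ of $H\cup\Delta_1\cup\dots\cup\Delta_s$. **Proposition (From local to global).** Let $n\ge 2$, $L$, $K_1$, $K$, $K_2$ be positive integers with $K_2>K>100K_1$, and let $G$ be an $n$-vertex graph satisfying the following two properties. * **(L1)** For every integer $3\le\ell\le L$ there are no subgraphs $H,C\subseteq G$ such that $H$ is connected, $C$ is an $\ell$-cycle, $|V(H)|\in[K_1\ell\ln n,\,K_2\ell\ln n]$, and $H$ activates $C$ in $G$ via a nice activation process. * **(L2)** For every integer $4\le\ell\le L$ there is an $\ell$-cycle $C\subseteq G$ such that no connected subgraph $H\subseteq G$ with $|V(H)|\in[\ell,\,K\ell\ln n]$ activates $C$ in $G$ via a nice activation process. Then there is no tree $T\subseteq G$ of diameter at most $L/100$ that activates $G$. -/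

import Mathlib

namespace TriangleBootstrap

variable {V : Type*}

/-- The subgraph of `G` spanned by a vertex set `t`; when `t` is a 3-clique this is the triangle
on `t`, with its three vertices and three edges. -/
def triangle (G : SimpleGraph V) (t : Finset V) : G.Subgraph :=
  (⊤ : G.Subgraph).induce (t : Set V)

/-- The graph `H ∪ Δ₁ ∪ ⋯ ∪ Δₖ`, where the sequence of triangles is `Δ₁, …, Δₛ`
(indexed from `0` in `tri`). -/
def stage (G : SimpleGraph V) (H : G.Subgraph) {s : ℕ} (tri : Fin s → Finset V) (k : ℕ) :
    G.Subgraph :=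
  H ⊔ ⨆ (i : Fin s) (_ : (i : ℕ) < k), triangle G (tri i)

/-- An activation process `(H; Δ₁, …, Δₛ)` of the `K₃`-bootstrap percolation in `G`: each `Δᵢ` is a
triangle of `G`, and exactly one of its three edges does not belong to `H ∪ Δ₁ ∪ ⋯ ∪ Δᵢ₋₁`;
this is the edge activated at step `i`. -/
structure ActivationProcess (G : SimpleGraph V) where
  /-- the initial graph `H` -/
  start : G.Subgraph
  /-- the number `s` of steps -/
  length : ℕ
  /-- the vertex sets of the triangles -/
  tri : Fin length → Finset V
  isClique_tri : ∀ i, G.IsNClique 3 (tri i)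
  existsUnique_new : ∀ i : Fin length,
    ∃! e : Sym2 V, e ∈ (triangle G (tri i)).edgeSet ∧ e ∉ (stage G start tri i).edgeSet

namespace ActivationProcess

variable {G : SimpleGraph V}

/-- The final graph `H ∪ Δ₁ ∪ ⋯ ∪ Δₛ`, the 1-skeleton of the activation complex. -/
def final (A : ActivationProcess G) : G.Subgraph :=
  stage G A.start A.tri A.length

/-- The process activates `G'` if all of `G'` is present in the final graph. -/
def Activates (A : ActivationProcess G) (G' : G.Subgraph) : Prop :=
  G' ≤ A.final

/-- The contribution of `e`: the number of triangles `Δᵢ` that contain `e` and do not activate it,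
that is, `e` already belongs to `H ∪ Δ₁ ∪ ⋯ ∪ Δᵢ₋₁`. -/
noncomputable def contribution (A : ActivationProcess G) (e : Sym2 V) : ℕ :=
  {i : Fin A.length | e ∈ (triangle G (A.tri i)).edgeSet ∧
    e ∈ (stage G A.start A.tri i).edgeSet}.ncard

open Classical in
/-- The excess of `e`, with respect to the activated graph `G'`. -/
noncomputable def excess (A : ActivationProcess G) (G' : G.Subgraph) (e : Sym2 V) : ℤ :=
  if e ∈ G'.edgeSet \ A.start.edgeSet then (A.contribution e : ℤ)
  else if e ∈ A.start.edgeSet \ G'.edgeSet then (A.contribution e : ℤ) - 2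
  else (A.contribution e : ℤ) - 1

/-- As a process activating `G'`, the process is nice if every edge of its activation complex has
nonnegative excess. -/
def IsNice (A : ActivationProcess G) (G' : G.Subgraph) : Prop :=
  ∀ e ∈ A.final.edgeSet, 0 ≤ A.excess G' e

end ActivationProcess

variable {G : SimpleGraph V}

/-- `H` activates `G'` in `G`. -/
def Activates (H G' : G.Subgraph) : Prop :=
  ∃ A : ActivationProcess G, A.start = H ∧ A.Activates G'

/-- `H` activates `G'` in `G` via a nice activation process. -/
def NicelyActivates (H G' : G.Subgraph) : Prop :=
  ∃ A : ActivationProcess G, A.start = H ∧ A.Activates G' ∧ A.IsNice G'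

/-- The subgraph `C` of `G` is an `ℓ`-cycle. -/
def IsCycleOfLength (C : G.Subgraph) (ℓ : ℕ) : Prop :=
  ∃ (v : V) (w : G.Walk v v), w.IsCycle ∧ w.length = ℓ ∧ w.toSubgraph = C

end TriangleBootstrap

namespace TriangleBootstrap

section

open Classical

variable {V : Type*} {G : SimpleGraph V}

/-! Suppose a tree `T` of diameter at most `L / 100` activates `G`. Call a set of triangles of the
process a filling of a cycle if its boundary modulo 2 is that cycle, and measure it by its number of
vertices.

A filling with fewest triangles, run in the original order, is itself an activation process: it
starts from the edges that its triangles do not activate, on the same vertices. It is nice because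
off the cycle every edge lies in an even, positive number of triangles, and its initial graph is
connected because triangles in other components could be dropped (`Fills.exists_nicelyActivates`).
Hence by (L1) a filling of an `ℓ`-cycle with at most `K₂ ℓ ln n` vertices can be replaced by one
with at most `K₁ ℓ ln n`.

By induction along the process, every cycle of length `ℓ ≤ L` has a filling with at most `K₁ ℓ ln n`
vertices (`fills_of_isCycle`). The tree has no cycles. After a new triangle, a cycle is rerouted
around the new edge, which lengthens it by at most one, and the resulting closed walk splits into
older short cycles. If its length is `L + 1`, a path of the tree first cuts it into two shorter
closed walks (`fills_of_closed_succ`). The cost is at most `3 K₁ ℓ ln n`, and (L1) brings it back to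
`K₁ ℓ ln n`. At the end every 4-cycle is nicely activated by a small connected graph, against (L2).
-/

theorem mem_edgeSet_triangle {t : Finset V} {u v : V} :
    s(u, v) ∈ (triangle G t).edgeSet ↔ u ∈ t ∧ v ∈ t ∧ G.Adj u v := by
  simp [triangle]

theorem mem_edgeSet_stage {H : G.Subgraph} {s : ℕ} {tri : Fin s → Finset V} {k : ℕ} {e : Sym2 V} :
    e ∈ (stage G H tri k).edgeSet ↔
      e ∈ H.edgeSet ∨ ∃ i : Fin s, (i : ℕ) < k ∧ e ∈ (triangle G (tri i)).edgeSet := by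
  simp [stage]

theorem mem_verts_stage {H : G.Subgraph} {s : ℕ} {tri : Fin s → Finset V} {k : ℕ} {v : V} :
    v ∈ (stage G H tri k).verts ↔ v ∈ H.verts ∨ ∃ i : Fin s, (i : ℕ) < k ∧ v ∈ tri i := by
  simp [stage, triangle]

theorem exists_third_vertex {t : Finset V} (ht : G.IsNClique 3 t) {u v : V} (hu : u ∈ t)
    (hv : v ∈ t) (huv : u ≠ v) : ∃ w, t = {u, v, w} ∧ G.Adj u w ∧ G.Adj w v := by
  obtain ⟨a, b, c, hab, hac, hbc, rfl⟩ := SimpleGraph.is3Clique_iff.1 ht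
  simp only [Finset.mem_insert, Finset.mem_singleton] at hu hv
  have h1 := hab.symm
  have h2 := hac.symm
  have h3 := hbc.symm
  rcases hu with rfl | rfl | rfl <;> rcases hv with rfl | rfl | rfl <;>
    first
    | exact absurd rfl huv
    | exact ⟨c, by ext; simp; try tauto, by assumption, by assumption⟩
    | exact ⟨b, by ext; simp; try tauto, by assumption, by assumption⟩
    | exact ⟨a, by ext; simp; try tauto, by assumption, by assumption⟩

theorem exists_edge_of_mem_clique {t : Finset V} (ht : G.IsNClique 3 t) {v : V} (hv : v ∈ t) :
    ∃ w, s(v, w) ∈ (triangle G t).edgeSet := by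
  obtain ⟨w, hw, hwv⟩ := Finset.exists_mem_ne (by rw [ht.card_eq]; norm_num) v
  exact ⟨w, mem_edgeSet_triangle.2 ⟨hv, hw, ht.isClique hv hw hwv.symm⟩⟩

namespace ActivationProcess

variable (A : ActivationProcess G)

theorem mem_edgeSet_final {e : Sym2 V} : e ∈ A.final.edgeSet ↔
    e ∈ A.start.edgeSet ∨ ∃ i, e ∈ (triangle G (A.tri i)).edgeSet := by
  simp [final, mem_edgeSet_stage]

/-- The edge activated at step `i`. -/
noncomputable def newEdge (i : Fin A.length) : Sym2 V := (A.existsUnique_new i).choose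

variable {A}

theorem newEdge_mem (i : Fin A.length) : A.newEdge i ∈ (triangle G (A.tri i)).edgeSet :=
  (A.existsUnique_new i).choose_spec.1.1

theorem newEdge_notMem (i : Fin A.length) :
    A.newEdge i ∉ (stage G A.start A.tri i).edgeSet :=
  (A.existsUnique_new i).choose_spec.1.2

theorem eq_newEdge {i : Fin A.length} {e : Sym2 V} (h : e ∈ (triangle G (A.tri i)).edgeSet)
    (h' : e ∉ (stage G A.start A.tri i).edgeSet) : e = A.newEdge i :=
  (A.existsUnique_new i).choose_spec.2 e ⟨h, h'⟩

theorem newEdge_notMem_of_lt {i j : Fin A.length} (h : i < j) :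
    A.newEdge j ∉ (triangle G (A.tri i)).edgeSet := fun hi =>
  newEdge_notMem j (mem_edgeSet_stage.2 (Or.inr ⟨i, h, hi⟩))

theorem exists_stage_path {i : Fin A.length} {u v : V}
    (h : s(u, v) ∈ (triangle G (A.tri i)).edgeSet)
    (h' : s(u, v) ∉ (stage G A.start A.tri i).edgeSet) :
    ∃ w, (stage G A.start A.tri i).Adj u w ∧ (stage G A.start A.tri i).Adj w v ∧
      A.tri i = {u, v, w} := by
  obtain ⟨hu, hv, huv⟩ := mem_edgeSet_triangle.1 h
  obtain ⟨w, ht, huw, hwv⟩ := exists_third_vertex (A.isClique_tri i) hu hv huv.ne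
  have hw : w ∈ A.tri i := by simp [ht]
  have hn := eq_newEdge h h'
  refine ⟨w, ?_, ?_, ht⟩
  · by_contra hc
    have := eq_newEdge (e := s(u, w)) (mem_edgeSet_triangle.2 ⟨hu, hw, huw⟩) hc
    rw [← hn] at this
    simp only [Sym2.eq_iff] at this
    have := huv.ne; have := hwv.ne
    aesop
  · by_contra hc
    have := eq_newEdge (e := s(w, v)) (mem_edgeSet_triangle.2 ⟨hw, hv, hwv⟩) hc
    rw [← hn] at this
    simp only [Sym2.eq_iff] at this
    have := huv.ne; have := huw.ne
    aesop

theorem mem_stage_succ {k : ℕ} (hk : k < A.length) {e : Sym2 V} :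
    e ∈ (stage G A.start A.tri (k + 1)).edgeSet ↔
      e ∈ (stage G A.start A.tri k).edgeSet ∨ e ∈ (triangle G (A.tri ⟨k, hk⟩)).edgeSet := by
  simp only [mem_edgeSet_stage, Nat.lt_succ_iff_lt_or_eq]
  constructor
  · rintro (h | ⟨i, hi | hi, h⟩)
    · exact Or.inl (Or.inl h)
    · exact Or.inl (Or.inr ⟨i, hi, h⟩)
    · exact Or.inr (by subst hi; exact h)
  · rintro ((h | ⟨i, hi, h⟩) | h)
    · exact Or.inl h
    · exact Or.inr ⟨i, Or.inl hi, h⟩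
    · exact Or.inr ⟨⟨k, hk⟩, Or.inr rfl, h⟩

/-! ### Connected components and vertices of a process. -/

/-- Activation takes place inside the connected components of the initial graph. -/
theorem reachable_of_stage_adj (k : ℕ) : k ≤ A.length → ∀ {u v : V},
    (stage G A.start A.tri k).Adj u v →
    ∃ (hu : u ∈ A.start.verts) (hv : v ∈ A.start.verts),
      A.start.coe.Reachable ⟨u, hu⟩ ⟨v, hv⟩ := by
  induction k with
  | zero =>
    intro _ u v h
    have h : A.start.Adj u v := by
      simpa [← SimpleGraph.Subgraph.mem_edgeSet, mem_edgeSet_stage] using h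
    exact ⟨h.fst_mem, h.snd_mem, SimpleGraph.Adj.reachable h⟩
  | succ k ih =>
    intro hk u v h
    have ih := fun {u v} => @ih (by omega) u v
    by_cases hs : (stage G A.start A.tri k).Adj u v
    · exact ih hs
    · rw [← SimpleGraph.Subgraph.mem_edgeSet, mem_stage_succ (by omega)] at h
      obtain ⟨w, huw, hwv, -⟩ := exists_stage_path (h.resolve_left hs) hs
      obtain ⟨hu, hw, h1⟩ := ih huw
      obtain ⟨_, hv, h2⟩ := ih hwv
      exact ⟨hu, hv, h1.trans h2⟩

theorem reachable_of_final_adj {u v : V} (h : A.final.Adj u v) :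
    ∃ (hu : u ∈ A.start.verts) (hv : v ∈ A.start.verts),
      A.start.coe.Reachable ⟨u, hu⟩ ⟨v, hv⟩ :=
  reachable_of_stage_adj A.length le_rfl h

/-- Every vertex of a triangle lies on one of its edges, and activated edges join vertices of the
initial graph. -/
theorem verts_final : A.final.verts = A.start.verts := by
  ext v
  simp only [final, mem_verts_stage, Fin.is_lt, true_and, or_iff_left_iff_imp]
  rintro ⟨i, hi⟩
  obtain ⟨w, hw⟩ := exists_edge_of_mem_clique (A.isClique_tri i) hi
  exact (reachable_of_final_adj (A.mem_edgeSet_final.2 (Or.inr ⟨i, hw⟩))).1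

/-! ### Triangle degrees of edges and niceness. -/

variable (A) in
/-- The number of triangles containing `e`. -/
noncomputable def deg (e : Sym2 V) : ℕ :=
  {i : Fin A.length | e ∈ (triangle G (A.tri i)).edgeSet}.ncard

theorem deg_le_contribution {e : Sym2 V} (he : e ∈ A.start.edgeSet) :
    A.deg e ≤ A.contribution e :=
  Set.ncard_le_ncard (fun _ hi => ⟨hi, mem_edgeSet_stage.2 (Or.inl he)⟩)

/-- An edge is activated at most once, so at most one of its triangles does not contribute. -/
theorem deg_le_contribution_add_one (e : Sym2 V) : A.deg e ≤ A.contribution e + 1 := by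
  set N := {i : Fin A.length | e ∈ (triangle G (A.tri i)).edgeSet ∧
    e ∉ (stage G A.start A.tri i).edgeSet}
  have hN : N.ncard ≤ 1 := by
    rw [Set.ncard_le_one]
    rintro i ⟨hi, hi'⟩ j ⟨hj, hj'⟩
    by_contra hij
    rcases lt_or_gt_of_ne hij with h | h
    · exact hj' (mem_edgeSet_stage.2 (Or.inr ⟨i, h, hi⟩))
    · exact hi' (mem_edgeSet_stage.2 (Or.inr ⟨j, h, hj⟩))
  refine le_trans (Set.ncard_le_ncard (t := _ ∪ N) fun i hi => ?_)
    ((Set.ncard_union_le _ _).trans (Nat.add_le_add_left hN _))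
  by_cases h : e ∈ (stage G A.start A.tri i).edgeSet
  · exact Or.inl ⟨hi, h⟩
  · exact Or.inr ⟨hi, h⟩

/-- A process whose triangles form a 2-chain with boundary `C` and cover all edges is nice. -/
theorem isNice_of_parity {C : G.Subgraph}
    (hpos : ∀ e ∈ A.final.edgeSet, 0 < A.deg e)
    (hpar : ∀ e, Odd (A.deg e) ↔ e ∈ C.edgeSet) : A.IsNice C := by
  intro e he
  have h0 := hpos e he
  have h1 := A.deg_le_contribution_add_one e
  have h2 : e ∈ A.start.edgeSet → A.deg e ≤ A.contribution e := deg_le_contribution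
  have h3 : e ∉ C.edgeSet → 2 ≤ A.deg e := fun h => by
    have := (hpar e).not.2 h
    rw [Nat.not_odd_iff_even] at this
    obtain ⟨r, hr⟩ := this
    omega
  unfold excess
  simp only [Set.mem_sdiff]
  split_ifs with hc hd
  · positivity
  · have := h2 hd.1; have := h3 hd.2; omega
  · by_cases hs : e ∈ A.start.edgeSet
    · have := h2 hs; omega
    · have := h3 (fun hC => hc ⟨hC, hs⟩); omega

/-! ### Chains of triangles modulo 2 and fillings. -/

variable (A)

/-- The boundary modulo 2 of a set of triangles of an activation process. -/
noncomputable def boundary (S : Finset (Fin A.length)) (e : Sym2 V) : ZMod 2 :=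
  ∑ i ∈ S, if e ∈ (triangle G (A.tri i)).edgeSet then 1 else 0

/-- `c` is the boundary modulo 2 of a set of triangles of the process which together have at most
`m` vertices. -/
def Fills (c : Sym2 V → ZMod 2) (m : ℝ) : Prop :=
  ∃ S : Finset (Fin A.length), A.boundary S = c ∧ ((S.biUnion A.tri).card : ℝ) ≤ m

variable {A}

theorem boundary_eq_card (S : Finset (Fin A.length)) (e : Sym2 V) : A.boundary S e =
    ((S.filter fun i => e ∈ (triangle G (A.tri i)).edgeSet).card : ZMod 2) := by
  simp [boundary, Finset.sum_boole]

theorem boundary_symmDiff (S S' : Finset (Fin A.length)) :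
    A.boundary (symmDiff S S') = A.boundary S + A.boundary S' := by
  ext e
  simp only [boundary, Pi.add_apply]
  set g : Fin A.length → ZMod 2 := fun i =>
    if e ∈ (triangle G (A.tri i)).edgeSet then 1 else 0
  have h : symmDiff S S' = (S \ S') ∪ (S' \ S) := rfl
  rw [h, Finset.sum_union (by
    rw [Finset.disjoint_left]; intro a; simp only [Finset.mem_sdiff]; tauto),
    ← Finset.sum_sdiff (Finset.inter_subset_left : S ∩ S' ⊆ S) (f := g),
    ← Finset.sum_sdiff (Finset.inter_subset_right : S ∩ S' ⊆ S') (f := g),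
    Finset.sdiff_inter_self_left, Finset.sdiff_inter_self_right]
  linear_combination -(CharTwo.add_self_eq_zero (∑ i ∈ S ∩ S', g i))

theorem Fills.mono {c : Sym2 V → ZMod 2} {m m' : ℝ} (h : A.Fills c m) (hm : m ≤ m') :
    A.Fills c m' :=
  let ⟨S, hS, hc⟩ := h
  ⟨S, hS, hc.trans hm⟩

theorem Fills.zero : A.Fills 0 0 := ⟨∅, by ext; simp [boundary], by simp⟩

theorem Fills.add {c c' : Sym2 V → ZMod 2} {m m' : ℝ} (h : A.Fills c m) (h' : A.Fills c' m') :
    A.Fills (c + c') (m + m') := by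
  obtain ⟨S, rfl, hm⟩ := h
  obtain ⟨S', rfl, hm'⟩ := h'
  refine ⟨symmDiff S S', boundary_symmDiff S S', le_trans ?_ (add_le_add hm hm')⟩
  have h1 : (symmDiff S S').biUnion A.tri ⊆ S.biUnion A.tri ∪ S'.biUnion A.tri := by
    rw [← Finset.union_biUnion]
    refine Finset.biUnion_subset_biUnion_of_subset_left _ fun i hi => ?_
    rw [Finset.mem_symmDiff] at hi
    rw [Finset.mem_union]
    tauto
  exact_mod_cast (Finset.card_le_card h1).trans (Finset.card_union_le _ _)

theorem Fills.triangle (i : Fin A.length) :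
    A.Fills (fun e => if e ∈ (triangle G (A.tri i)).edgeSet then 1 else 0) 3 :=
  ⟨{i}, by ext; simp only [boundary, Finset.sum_singleton], by simp [(A.isClique_tri i).card_eq]⟩

/-! ### The activation process supported by a chain -/

/-- The graph of all edges of the triangles in `S` that are not activated by a triangle in `S`. -/
noncomputable def chainStart (S : Finset (Fin A.length)) : G.Subgraph :=
  (⨆ i ∈ S, TriangleBootstrap.triangle G (A.tri i)).deleteEdges (A.newEdge '' (S : Set (Fin A.length)))

theorem mem_edgeSet_chainStart {S : Finset (Fin A.length)} {e : Sym2 V} :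
    e ∈ (chainStart S).edgeSet ↔
      (∃ i ∈ S, e ∈ (TriangleBootstrap.triangle G (A.tri i)).edgeSet) ∧
        ∀ i ∈ S, e ≠ A.newEdge i := by
  induction e with
  | _ u v =>
    simp [chainStart, SimpleGraph.Subgraph.mem_edgeSet, eq_comm]

/-- Deleting edges keeps vertices, so the size in `Fills` is exactly the order of this initial
graph. -/
theorem verts_chainStart (S : Finset (Fin A.length)) :
    (chainStart S).verts = (S.biUnion A.tri : Set V) := by
  ext v
  simp [chainStart, TriangleBootstrap.triangle]

theorem mem_stage_chain {S : Finset (Fin A.length)} (j : Fin S.card) {e : Sym2 V} :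
    e ∈ (stage G (chainStart S) (fun j => A.tri (S.orderEmbOfFin rfl j)) j).edgeSet ↔
      e ∈ (chainStart S).edgeSet ∨
        ∃ i ∈ S, i < S.orderEmbOfFin rfl j ∧
          e ∈ (TriangleBootstrap.triangle G (A.tri i)).edgeSet := by
  rw [mem_edgeSet_stage]
  refine or_congr Iff.rfl ⟨?_, ?_⟩
  · rintro ⟨i, hi, h⟩
    exact ⟨_, S.orderEmbOfFin_mem rfl i, (S.orderEmbOfFin rfl).lt_iff_lt.2 hi, h⟩
  · rintro ⟨i, hi, hij, h⟩
    have : i ∈ Set.range (S.orderEmbOfFin rfl) := by simpa using hi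
    obtain ⟨k, rfl⟩ := this
    exact ⟨k, (S.orderEmbOfFin rfl).lt_iff_lt.1 hij, h⟩

variable (A) in
/-- The process that uses only the triangles in `S`, in their original order. -/
noncomputable def ofChain (S : Finset (Fin A.length)) : ActivationProcess G where
  start := chainStart S
  length := S.card
  tri j := A.tri (S.orderEmbOfFin rfl j)
  isClique_tri j := A.isClique_tri _
  existsUnique_new j := by
    set i := S.orderEmbOfFin rfl j with hi
    have hiS : i ∈ S := S.orderEmbOfFin_mem rfl j
    refine ⟨A.newEdge i, ⟨newEdge_mem i, ?_⟩, ?_⟩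
    · rw [mem_stage_chain, mem_edgeSet_chainStart]
      rintro (⟨-, h⟩ | ⟨k, -, hk, h⟩)
      · exact h i hiS rfl
      · exact newEdge_notMem_of_lt hk h
    -- A missing edge is the new edge of some `k ∈ S`. If `k < i` it would already be present; if `k
    -- > i` it would lie in a triangle before its own activation.
    · rintro e ⟨he, hs⟩
      rw [mem_stage_chain, mem_edgeSet_chainStart] at hs
      push Not at hs
      obtain ⟨k, hk, rfl⟩ := hs.1 ⟨i, hiS, he⟩
      rcases lt_trichotomy k i with h | h | h
      · exact absurd (newEdge_mem k) (hs.2 k hk h)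
      · rw [h]
      · exact absurd he (newEdge_notMem_of_lt h)

theorem mem_edgeSet_final_ofChain {S : Finset (Fin A.length)} {e : Sym2 V} :
    e ∈ (A.ofChain S).final.edgeSet ↔
      ∃ i ∈ S, e ∈ (TriangleBootstrap.triangle G (A.tri i)).edgeSet := by
  rw [mem_edgeSet_final]
  constructor
  · rintro (h | ⟨j, h⟩)
    · exact (mem_edgeSet_chainStart.1 h).1
    · exact ⟨_, S.orderEmbOfFin_mem rfl j, h⟩
  · rintro ⟨i, hi, h⟩
    have : i ∈ Set.range (S.orderEmbOfFin rfl) := by simpa using hi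
    obtain ⟨k, rfl⟩ := this
    exact Or.inr ⟨k, h⟩

theorem deg_ofChain (S : Finset (Fin A.length)) (e : Sym2 V) : (A.ofChain S).deg e =
    (S.filter fun i => e ∈ (TriangleBootstrap.triangle G (A.tri i)).edgeSet).card := by
  rw [← Set.ncard_coe_finset]
  refine (Set.ncard_image_of_injective {j : Fin S.card | e ∈ (TriangleBootstrap.triangle G
    (A.tri (S.orderEmbOfFin rfl j))).edgeSet} (S.orderEmbOfFin rfl).injective).symm.trans
    (congrArg Set.ncard ?_)
  ext i
  simp only [Set.mem_image, Set.mem_ofPred_eq, Finset.coe_filter]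
  constructor
  · rintro ⟨j, hj, rfl⟩
    exact ⟨S.orderEmbOfFin_mem rfl j, hj⟩
  · rintro ⟨hi, h⟩
    have : i ∈ Set.range (S.orderEmbOfFin rfl) := by simpa using hi
    obtain ⟨k, rfl⟩ := this
    exact ⟨k, h, rfl⟩

/-- The indicator modulo 2 of the edges of a walk. -/
noncomputable def walkChain {u v : V} (w : G.Walk u v) (e : Sym2 V) : ZMod 2 := w.edges.count e

/-- A chain of triangles bounding a cycle can be cut down to one that supports a nice process
with a connected initial graph. -/
theorem Fills.exists_nicelyActivates {v : V} {w : G.Walk v v} (hw : w.IsCycle) {m : ℝ}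
    (h : A.Fills (walkChain w) m) :
    ∃ H : G.Subgraph, H.Connected ∧ NicelyActivates H w.toSubgraph ∧
      (w.length : ℝ) ≤ H.verts.ncard ∧ (H.verts.ncard : ℝ) ≤ m ∧
      A.Fills (walkChain w) H.verts.ncard := by
  -- The number of triangles is minimised, while the bound on the vertices is kept as a constraint.
  have hex : ∃ k : ℕ, ∃ S : Finset (Fin A.length), S.card = k ∧ A.boundary S = walkChain w ∧
      ((S.biUnion A.tri).card : ℝ) ≤ m := by
    obtain ⟨S, h1, h2⟩ := h
    exact ⟨_, S, rfl, h1, h2⟩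
  obtain ⟨S, hk, hbd, hm⟩ := Nat.find_spec hex
  have hmin : ∀ S' ⊆ S, A.boundary S' = walkChain w → S' = S := by
    intro S' hS' hb
    refine Finset.eq_of_subset_of_card_le hS' ?_
    rw [hk]
    refine Nat.find_min' hex ⟨S', rfl, hb, le_trans ?_ hm⟩
    exact_mod_cast Finset.card_le_card (Finset.biUnion_subset_biUnion_of_subset_left _ hS')
  set B := A.ofChain S with hB
  have hpar : ∀ e, Odd (B.deg e) ↔ e ∈ w.toSubgraph.edgeSet := by
    intro e
    have h1 := congrFun hbd e
    rw [boundary_eq_card, ← deg_ofChain, walkChain] at h1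
    rw [SimpleGraph.Walk.mem_edges_toSubgraph, ← ZMod.natCast_eq_one_iff_odd, h1]
    by_cases he : e ∈ w.edges
    · simp [List.count_eq_one_of_mem hw.edges_nodup he, he]
    · simp [List.count_eq_zero_of_not_mem he, he]
  have hpos : ∀ e, e ∈ B.final.edgeSet ↔ 0 < B.deg e := by
    intro e
    rw [hB, mem_edgeSet_final_ofChain, deg_ofChain, Finset.card_pos, Finset.filter_nonempty_iff]
  have hnice : B.IsNice w.toSubgraph := isNice_of_parity (fun e he => (hpos e).1 he) hpar
  have hact : B.Activates w.toSubgraph := by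
    rw [Activates, SimpleGraph.Walk.toSubgraph_le_iff hw.not_nil]
    intro e he
    exact (hpos e).2 ((hpar e).2 (w.mem_edges_toSubgraph.2 he)).pos
  have hverts : (chainStart S).verts = (S.biUnion A.tri : Set V) := verts_chainStart S
  have hncard : (chainStart S).verts.ncard = (S.biUnion A.tri).card := by
    rw [hverts, Set.ncard_coe_finset]
  have hsupp : ∀ x ∈ w.support, x ∈ (chainStart S).verts := by
    intro x hx
    have : x ∈ B.final.verts := hact.1 (w.mem_verts_toSubgraph.2 hx)
    rwa [verts_final] at this
  refine ⟨chainStart S, ?_, ⟨B, rfl, hact, hnice⟩, ?_, ?_, S, hbd, ?_⟩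
  · have hv : v ∈ (chainStart S).verts := hsupp v w.start_mem_support
    -- `R` is the component of the cycle. Triangles lie inside or outside it, and those outside
    -- contribute nothing to the boundary, so minimality leaves none.
    set R : Set V := {x | ∃ hx, (chainStart S).coe.Reachable ⟨v, hv⟩ ⟨x, hx⟩} with hR
    have hRadj : ∀ {x y}, B.final.Adj x y → x ∈ R → y ∈ R := by
      rintro x y hxy ⟨hx, h⟩
      obtain ⟨_, hy, h'⟩ := reachable_of_final_adj hxy
      exact ⟨hy, h.trans h'⟩
    have hRw : ∀ x ∈ w.support, x ∈ R := by
      intro x hx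
      refine ⟨hsupp x hx, ?_⟩
      have hvR : v ∈ R := ⟨hv, SimpleGraph.Reachable.refl _⟩
      suffices x ∈ R from this.2
      have key : ∀ {a b : V} (p : G.Walk a b), (∀ e ∈ p.edges, e ∈ B.final.edgeSet) → a ∈ R →
          ∀ x ∈ p.support, x ∈ R := by
        intro a b p
        induction p with
        | nil => simp +contextual
        | cons hab p ih =>
          intro hp ha x hx
          simp only [SimpleGraph.Walk.edges_cons, List.mem_cons, forall_eq_or_imp] at hp
          rw [SimpleGraph.Walk.support_cons, List.mem_cons] at hx
          rcases hx with rfl | hx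
          · exact ha
          · exact ih hp.2 (hRadj hp.1 ha) x hx
      exact key w ((w.toSubgraph_le_iff hw.not_nil).1 hact) hvR x hx
    have hSR : S.filter (fun i => ∃ x ∈ A.tri i, x ∈ R) = S := by
      refine hmin _ (Finset.filter_subset _ _) ?_
      rw [← hbd]
      ext e
      induction e with
      | _ x y =>
        by_cases hx : x ∈ R
        · simp only [boundary_eq_card, Finset.filter_filter]
          congr 2
          refine Finset.filter_congr fun i _ => ⟨fun h => h.2, fun h => ⟨⟨x, ?_, hx⟩, h⟩⟩
          exact (mem_edgeSet_triangle.1 h).1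
        · rw [hbd, walkChain, List.count_eq_zero_of_not_mem
            (fun h => hx (hRw x (w.fst_mem_support_of_mem_edges h))), boundary]
          refine (Finset.sum_eq_zero fun i hi => ?_).trans Nat.cast_zero.symm
          rw [if_neg]
          intro h
          obtain ⟨hiS, z, hz, hzR⟩ := Finset.mem_filter.1 hi
          apply hx
          by_cases hzx : z = x
          · exact hzx ▸ hzR
          · refine hRadj ?_ hzR
            rw [← SimpleGraph.Subgraph.mem_edgeSet, mem_edgeSet_final_ofChain]
            have hxi := (mem_edgeSet_triangle.1 h).1
            exact ⟨i, hiS, mem_edgeSet_triangle.2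
              ⟨hz, hxi, (A.isClique_tri i).isClique hz hxi hzx⟩⟩
    have hall : ∀ y (hy : y ∈ (chainStart S).verts),
        (chainStart S).coe.Reachable ⟨v, hv⟩ ⟨y, hy⟩ := by
      intro y hy
      have hy' := hy
      rw [hverts, Finset.mem_coe, Finset.mem_biUnion] at hy'
      obtain ⟨i, hi, hyi⟩ := hy'
      obtain ⟨hiS, z, hz, hzR⟩ := Finset.mem_filter.1 (hSR.symm ▸ hi :
        i ∈ S.filter (fun i => ∃ x ∈ A.tri i, x ∈ R))
      suffices y ∈ R from this.2
      by_cases hzy : z = y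
      · exact hzy ▸ hzR
      · refine hRadj ?_ hzR
        rw [← SimpleGraph.Subgraph.mem_edgeSet, mem_edgeSet_final_ofChain]
        exact ⟨i, hiS, mem_edgeSet_triangle.2 ⟨hz, hyi, (A.isClique_tri i).isClique hz hyi hzy⟩⟩
    rw [SimpleGraph.Subgraph.connected_iff']
    have : Nonempty (chainStart S).verts := ⟨⟨v, hv⟩⟩
    exact ⟨fun a b => (hall a a.2).symm.trans (hall b b.2)⟩
  -- The tail drops the repeated base point, leaving exactly `w.length` distinct vertices.
  · have h1 : w.support.tail.toFinset ⊆ S.biUnion A.tri := by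
      intro x hx
      have := hsupp x (List.mem_of_mem_tail (List.mem_toFinset.1 hx))
      rwa [hverts, Finset.mem_coe] at this
    have h2 := Finset.card_le_card h1
    rw [List.toFinset_card_of_nodup hw.support_nodup, List.length_tail,
      SimpleGraph.Walk.length_support, Nat.add_sub_cancel] at h2
    rw [hncard]
    exact_mod_cast h2
  · rw [hncard]; exact hm
  · rw [hncard]

/-! ### Splitting closed walks into cycles. -/

@[simp] theorem walkChain_nil {u : V} : walkChain (SimpleGraph.Walk.nil : G.Walk u u) = 0 := by
  ext e; simp [walkChain]

theorem walkChain_cons {u v x : V} (h : G.Adj u v) (p : G.Walk v x) :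
    walkChain (p.cons h) = Pi.single s(u, v) 1 + walkChain p := by
  ext e
  simp only [walkChain, SimpleGraph.Walk.edges_cons, List.count_cons, Nat.cast_add, Pi.add_apply,
    Pi.single_apply, beq_iff_eq, Nat.cast_ite, Nat.cast_one, Nat.cast_zero, @eq_comm _ e]
  ring

theorem walkChain_append {u v x : V} (p : G.Walk u v) (q : G.Walk v x) :
    walkChain (p.append q) = walkChain p + walkChain q := by
  ext e; simp [walkChain]

theorem walkChain_reverse {u v : V} (p : G.Walk u v) : walkChain p.reverse = walkChain p := by
  ext e; simp [walkChain]

theorem chain_add_self (c : Sym2 V → ZMod 2) : c + c = 0 :=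
  funext fun _ => CharTwo.add_self_eq_zero _

/-- A closed walk consisting of an edge and a path is a cycle or has an empty chain. -/
theorem isCycle_or_walkChain_eq_zero {u v : V} (h : G.Adj u v) {p : G.Walk v u} (hp : p.IsPath) :
    (p.cons h).IsCycle ∨ walkChain (p.cons h) = 0 := by
  by_cases he : s(u, v) ∈ p.edges
  · right
    cases p with
    | nil => simp at he
    | @cons _ y _ h2 r =>
      rw [SimpleGraph.Walk.cons_isPath_iff] at hp
      rw [SimpleGraph.Walk.edges_cons, List.mem_cons] at he
      have hy : u = y := by
        rcases he with he | he
        · rw [Sym2.eq_iff] at he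
          rcases he with ⟨h1, -⟩ | ⟨h1, -⟩
          · exact absurd h1 h.ne
          · exact h1
        · exact absurd (r.snd_mem_support_of_mem_edges he) hp.2
      subst hy
      rw [(SimpleGraph.Walk.isPath_iff_nil.1 hp.1).eq_nil, walkChain_cons, walkChain_cons, walkChain_nil,
        add_zero, Sym2.eq_swap]
      exact chain_add_self _
  · exact Or.inl ((SimpleGraph.Walk.cons_isCycle_iff p h).2 ⟨hp, he⟩)

/-- If all short cycles have small fillings, a short walk can be turned into a path
with the same ends at a small cost. -/
theorem exists_path_of_cycles {E : Set (Sym2 V)} {L : ℕ} {κ : ℝ} (hκ : 0 ≤ κ)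
    (hE : ∀ (x : V) (c : G.Walk x x), c.IsCycle → (∀ e ∈ c.edges, e ∈ E) → c.length ≤ L →
      A.Fills (walkChain c) (κ * c.length))
    {u v : V} (p : G.Walk u v) : (∀ e ∈ p.edges, e ∈ E) → p.length ≤ L →
    ∃ q : G.Walk u v, q.IsPath ∧ (∀ e ∈ q.edges, e ∈ p.edges) ∧ q.length ≤ p.length ∧
      A.Fills (walkChain p + walkChain q) (κ * (p.length - q.length)) := by
  induction p with
  | nil =>
    intro _ _
    exact ⟨.nil, by simp, by simp, le_rfl, by simpa using Fills.zero⟩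
  | @cons u x v h p ih =>
    intro hp hL
    simp only [SimpleGraph.Walk.edges_cons, List.mem_cons, forall_eq_or_imp] at hp
    rw [SimpleGraph.Walk.length_cons] at hL
    obtain ⟨q, hq, hqp, hql, hf⟩ := ih hp.2 (by omega)
    by_cases hu : u ∈ q.support
    · set t := q.takeUntil u hu with ht
      set d := q.dropUntil u hu with hd
      have hspec : t.append d = q := q.take_spec hu
      have hlen : t.length + d.length = q.length := by
        rw [← hspec, SimpleGraph.Walk.length_append]
      have hchain : walkChain q = walkChain t + walkChain d := by rw [← hspec, walkChain_append]
      -- The new edge closes a loop on the path. The loop is filled and erased, at a cost of `κ` per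
      -- edge removed.
      have hcyc : A.Fills (walkChain (t.cons h)) (κ * (t.length + 1)) := by
        rcases isCycle_or_walkChain_eq_zero h (hq.takeUntil hu) with hc | hc
        · have := hE u (t.cons h) hc (by
            simp only [SimpleGraph.Walk.edges_cons, List.mem_cons, forall_eq_or_imp]
            exact ⟨hp.1, fun e he => hp.2 e (hqp e (q.edges_takeUntil_subset_edges hu he))⟩)
            (by rw [SimpleGraph.Walk.length_cons]; omega)
          simpa using this
        · rw [hc]
          exact Fills.zero.mono (by positivity)
      refine ⟨d, hq.dropUntil hu, fun e he => ?_, ?_, ?_⟩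
      · exact List.mem_cons_of_mem _ (hqp e (q.edges_dropUntil_subset_edges hu he))
      · rw [SimpleGraph.Walk.length_cons]; omega
      · have h1 := hf.add hcyc
        rw [walkChain_cons, hchain] at h1
        rw [walkChain_cons, SimpleGraph.Walk.length_cons]
        convert h1 using 1
        · linear_combination -(chain_add_self (walkChain t))
        · rw [← hlen]; push_cast; ring
    · refine ⟨q.cons h, hq.cons hu, ?_, by simpa using hql, ?_⟩
      · simp only [SimpleGraph.Walk.edges_cons, List.mem_cons]
        rintro e (he | he)
        · exact Or.inl he
        · exact Or.inr (hqp e he)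
      · rw [walkChain_cons, walkChain_cons]
        convert hf using 1
        · linear_combination chain_add_self (Pi.single s(u, x) (1 : ZMod 2))
        · simp

/-- Erasing all loops of a closed walk leaves the trivial path. -/
theorem fills_of_closed {E : Set (Sym2 V)} {L : ℕ} {κ : ℝ} (hκ : 0 ≤ κ)
    (hE : ∀ (x : V) (c : G.Walk x x), c.IsCycle → (∀ e ∈ c.edges, e ∈ E) → c.length ≤ L →
      A.Fills (walkChain c) (κ * c.length))
    {u : V} (p : G.Walk u u) (hp : ∀ e ∈ p.edges, e ∈ E) (hL : p.length ≤ L) :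
    A.Fills (walkChain p) (κ * p.length) := by
  obtain ⟨q, hq, -, -, h⟩ := exists_path_of_cycles hκ hE p hp hL
  rw [(SimpleGraph.Walk.isPath_iff_nil.1 hq).eq_nil] at h
  simpa using h

/-! ### Undoing one activation step. -/

theorem triangle_chain {t : Finset V} (ht : G.IsNClique 3 t) {u v w : V} (h : t = {u, v, w})
    (huv : G.Adj u v) (huw : G.Adj u w) (hwv : G.Adj w v) :
    (fun e => if e ∈ (TriangleBootstrap.triangle G t).edgeSet then (1 : ZMod 2) else 0) =
      Pi.single s(u, v) 1 + (Pi.single s(u, w) 1 + Pi.single s(w, v) 1) := by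
  subst h
  ext e
  induction e with
  | _ x y =>
    simp only [mem_edgeSet_triangle, Pi.add_apply, Pi.single_apply, Sym2.eq_iff,
      Finset.mem_insert, Finset.mem_singleton]
    have h1 := huv.ne
    have h2 := huw.ne
    have h3 := hwv.ne
    have h4 := huv.symm
    have h5 := huw.symm
    have h6 := hwv.symm
    by_cases hx : x = u ∨ x = v ∨ x = w
    · by_cases hy : y = u ∨ y = v ∨ y = w
      · rcases hx with rfl | rfl | rfl <;> rcases hy with rfl | rfl | rfl <;>
          simp_all [eq_comm]
      · push Not at hy
        simp [hy]
    · push Not at hx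
      simp [hx]

/-- Every walk in a stage can be pushed to the previous one across the last triangle. -/
theorem exists_walk_prev_stage {k : ℕ} (hk : k < A.length) {u v : V} (p : G.Walk u v) :
    (∀ e ∈ p.edges, e ∈ (stage G A.start A.tri (k + 1)).edgeSet) →
    ∃ q : G.Walk u v, (∀ e ∈ q.edges, e ∈ (stage G A.start A.tri k).edgeSet) ∧
      q.length = p.length + p.edges.count (A.newEdge ⟨k, hk⟩) ∧
      A.Fills (walkChain p + walkChain q) (3 * p.edges.count (A.newEdge ⟨k, hk⟩)) := by
  induction p with
  | nil =>
    intro _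
    exact ⟨.nil, by simp, by simp, by simpa using Fills.zero⟩
  | @cons u x v h p ih =>
    intro hp
    simp only [SimpleGraph.Walk.edges_cons, List.mem_cons, forall_eq_or_imp] at hp
    obtain ⟨q, hq, hlen, hf⟩ := ih hp.2
    by_cases hs : s(u, x) ∈ (stage G A.start A.tri k).edgeSet
    · have hne : s(u, x) ≠ A.newEdge ⟨k, hk⟩ := fun he => newEdge_notMem ⟨k, hk⟩ (he ▸ hs)
      refine ⟨q.cons h, ?_, ?_, ?_⟩
      · simp only [SimpleGraph.Walk.edges_cons, List.mem_cons, forall_eq_or_imp]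
        exact ⟨hs, hq⟩
      · simp only [SimpleGraph.Walk.edges_cons, SimpleGraph.Walk.length_cons,
          List.count_cons_of_ne hne, hlen]
        ring
      · rw [walkChain_cons, walkChain_cons, SimpleGraph.Walk.edges_cons, List.count_cons_of_ne hne]
        convert hf using 1
        linear_combination chain_add_self (Pi.single s(u, x) (1 : ZMod 2))
    · have ht := ((mem_stage_succ hk).1 hp.1).resolve_left hs
      have hnew := eq_newEdge (i := ⟨k, hk⟩) ht hs
      obtain ⟨w, huw, hwx, htri⟩ := exists_stage_path (i := ⟨k, hk⟩) ht hs
      refine ⟨(q.cons hwx.adj_sub).cons huw.adj_sub, ?_, ?_, ?_⟩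
      · simp only [SimpleGraph.Walk.edges_cons, List.mem_cons, forall_eq_or_imp]
        exact ⟨huw, hwx, hq⟩
      · simp only [SimpleGraph.Walk.edges_cons, SimpleGraph.Walk.length_cons, ← hnew,
          List.count_cons_self, hlen]
        ring
      · have h1 := hf.add (Fills.triangle ⟨k, hk⟩)
        rw [triangle_chain (A.isClique_tri _) htri h huw.adj_sub hwx.adj_sub] at h1
        rw [walkChain_cons, walkChain_cons, walkChain_cons, SimpleGraph.Walk.edges_cons, ← hnew,
          List.count_cons_self]
        convert h1 using 1
        · ring
        · rw [← hnew]; push_cast; ring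

/-! ### The initial tree and the induction along the process. -/

theorem verts_start_eq_univ (h : A.Activates ⊤) : A.start.verts = Set.univ := by
  rw [← verts_final, Set.eq_univ_iff_forall]
  exact fun x => h.1 (Set.mem_univ x)

theorem exists_start_walk [Finite V] (h : A.Activates ⊤) (hT : A.start.coe.IsTree) (u v : V) :
    ∃ t : G.Walk u v, (∀ e ∈ t.edges, e ∈ A.start.edgeSet) ∧
      t.length ≤ A.start.coe.diam := by
  have hV := verts_start_eq_univ h
  have hu : u ∈ A.start.verts := hV ▸ Set.mem_univ u
  have hv : v ∈ A.start.verts := hV ▸ Set.mem_univ v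
  have : Nonempty A.start.verts := ⟨⟨u, hu⟩⟩
  obtain ⟨t, ht⟩ := hT.connected.exists_walk_length_eq_dist ⟨u, hu⟩ ⟨v, hv⟩
  refine ⟨t.map A.start.hom, ?_, ?_⟩
  · intro e he
    have he' := (congrArg (e ∈ ·) (SimpleGraph.Walk.edges_map A.start.hom t)).mp he
    obtain ⟨f, hf, rfl⟩ := List.mem_map.1 he'
    have := t.edges_subset_edgeSet hf
    induction f with
    | _ x y => simpa using this
  · exact (SimpleGraph.Walk.length_map A.start.hom t).trans_le (ht.trans_le
      (SimpleGraph.dist_le_diam (SimpleGraph.connected_iff_ediam_ne_top.1 hT.connected)))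

theorem not_isCycle_of_start (h : A.Activates ⊤) (hT : A.start.coe.IsTree) {v : V}
    {c : G.Walk v v} (hc : c.IsCycle) : ¬ ∀ e ∈ c.edges, e ∈ A.start.edgeSet := by
  intro he
  have hsp : A.start.IsSpanning := fun x => verts_start_eq_univ h ▸ Set.mem_univ x
  have hac : A.start.spanningCoe.IsAcyclic :=
    (A.start.spanningCoeEquivCoeOfSpanning hsp).isAcyclic_iff.2 hT.isAcyclic
  exact hac _ (hc.transfer (H := A.start.spanningCoe) (by simpa using he))

/-- Closed walks that are one step too long can be cut in two by the initial tree. -/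
theorem fills_of_closed_succ [Finite V] (h : A.Activates ⊤) (hT : A.start.coe.IsTree) {L k : ℕ}
    (hD : 100 * A.start.coe.diam ≤ L) (hL : 100 ≤ L) {κ : ℝ} (hκ : 0 ≤ κ)
    (hE : ∀ (x : V) (c : G.Walk x x), c.IsCycle →
      (∀ e ∈ c.edges, e ∈ (stage G A.start A.tri k).edgeSet) → c.length ≤ L →
      A.Fills (walkChain c) (κ * c.length))
    {u : V} (p : G.Walk u u) (hp : ∀ e ∈ p.edges, e ∈ (stage G A.start A.tri k).edgeSet)
    {l : ℕ} (hl : 3 ≤ l) (hlL : l ≤ L) (hpl : p.length ≤ l + 1) :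
    A.Fills (walkChain p) (κ * (2 * l)) := by
  by_cases hlt : p.length ≤ L
  · refine (fills_of_closed hκ hE p hp hlt).mono (mul_le_mul_of_nonneg_left ?_ hκ)
    exact_mod_cast (by omega : p.length ≤ 2 * l)
  -- Here `l = L` and `p` has length `L + 1`. Both halves, closed up by a tree path of length at
  -- most `L / 100`, have length at most `L`.
  · obtain ⟨t, ht, htl⟩ := exists_start_walk h hT u (p.getVert (L / 2))
    have ht' : ∀ e ∈ t.edges, e ∈ (stage G A.start A.tri k).edgeSet :=
      fun e he => mem_edgeSet_stage.2 (Or.inl (ht e he))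
    have hspec : (p.take (L / 2)).append (p.drop (L / 2)) = p := by simp
    have hsub : ∀ e, e ∈ (p.take (L / 2)).edges ∨ e ∈ (p.drop (L / 2)).edges → e ∈ p.edges := by
      intro e he
      rw [← hspec, SimpleGraph.Walk.edges_append, List.mem_append]
      exact he
    have hl1 : (p.take (L / 2)).length ≤ L / 2 := by
      rw [SimpleGraph.Walk.take_length]; exact min_le_left _ _
    have hl2 : (p.drop (L / 2)).length = p.length - L / 2 := SimpleGraph.Walk.drop_length _ _
    have h1 := fills_of_closed hκ hE ((p.take (L / 2)).append t.reverse) (by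
      intro e he
      rw [SimpleGraph.Walk.edges_append, List.mem_append, SimpleGraph.Walk.edges_reverse,
        List.mem_reverse] at he
      exact he.elim (fun he => hp e (hsub e (Or.inl he))) (ht' e)) (by
      rw [SimpleGraph.Walk.length_append, SimpleGraph.Walk.length_reverse]; omega)
    have h2 := fills_of_closed hκ hE (t.append (p.drop (L / 2))) (by
      intro e he
      rw [SimpleGraph.Walk.edges_append, List.mem_append] at he
      exact he.elim (ht' e) (fun he => hp e (hsub e (Or.inr he)))) (by
      rw [SimpleGraph.Walk.length_append]; omega)
    have h3 := h1.add h2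
    have hchain : walkChain p = walkChain ((p.take (L / 2)).append t.reverse) +
        walkChain (t.append (p.drop (L / 2))) := by
      rw [walkChain_append, walkChain_append, walkChain_reverse]
      conv_lhs => rw [← hspec, walkChain_append]
      linear_combination -(chain_add_self (walkChain t))
    rw [hchain]
    refine h3.mono ?_
    rw [← mul_add]
    refine mul_le_mul_of_nonneg_left ?_ hκ
    rw [SimpleGraph.Walk.length_append, SimpleGraph.Walk.length_append,
      SimpleGraph.Walk.length_reverse]
    exact_mod_cast (by omega : (p.take (L / 2)).length + t.length +
      (t.length + (p.drop (L / 2)).length) ≤ 2 * l)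

/-- If fillings of short cycles that are not too big can be improved to small ones, all short
cycles have small fillings. -/
theorem fills_of_isCycle [Finite V] (h : A.Activates ⊤) (hT : A.start.coe.IsTree) {L : ℕ}
    (hD : 100 * A.start.coe.diam ≤ L) (hL : 100 ≤ L) {κ κ' : ℝ} (hκ : 1 ≤ κ) (hκ' : 3 * κ ≤ κ')
    (himp : ∀ (x : V) (c : G.Walk x x), c.IsCycle → c.length ≤ L →
      A.Fills (walkChain c) (κ' * c.length) → A.Fills (walkChain c) (κ * c.length))
    {k : ℕ} (hk : k ≤ A.length) : ∀ (x : V) (c : G.Walk x x), c.IsCycle →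
      (∀ e ∈ c.edges, e ∈ (stage G A.start A.tri k).edgeSet) → c.length ≤ L →
      A.Fills (walkChain c) (κ * c.length) := by
  induction k with
  | zero =>
    intro x c hc he _
    exact absurd (fun e h' => by simpa [mem_edgeSet_stage] using he e h')
      (not_isCycle_of_start h hT hc)
  | succ k ih =>
    intro x c hc he hcL
    have h3 := hc.three_le_length
    obtain ⟨q, hq, hlen, hf⟩ := exists_walk_prev_stage hk c he
    have hcount := List.nodup_iff_count_le_one.1 hc.edges_nodup (A.newEdge ⟨k, hk⟩)
    have hqf := fills_of_closed_succ h hT hD hL (by linarith) (ih (by omega)) q hq h3 hcL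
      (by omega)
    -- Rerouting costs at most `3 ≤ κ * c.length` and the closed walk at most `2 * κ * c.length`,
    -- which gives the factor 3 in `hκ'`.
    refine himp x c hc hcL ?_
    have hsum := hf.add hqf
    rw [add_assoc, chain_add_self, add_zero] at hsum
    refine hsum.mono ?_
    have hcount' : ((c.edges.count (A.newEdge ⟨k, hk⟩) : ℕ) : ℝ) ≤ 1 := by exact_mod_cast hcount
    have h3' : (3 : ℝ) ≤ c.length := by exact_mod_cast h3
    nlinarith

end ActivationProcess

end

end TriangleBootstrap

theorem mainTheorem5 {V : Type*} [Fintype V] (G : SimpleGraph V)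
    (n L K₁ K K₂ : ℕ) (hn : Fintype.card V = n) (hn2 : 2 ≤ n) (hL : 0 < L)
    (hK₁ : 0 < K₁) (hK : 100 * K₁ < K) (hK₂ : K < K₂)
    (hL1 : ∀ ℓ : ℕ, 3 ≤ ℓ → ℓ ≤ L →
      ¬ ∃ H C : G.Subgraph, TriangleBootstrap.IsCycleOfLength C ℓ ∧ H.Connected ∧
        (H.verts.ncard : ℝ) ∈
          Set.Icc ((K₁ : ℝ) * ℓ * Real.log n) ((K₂ : ℝ) * ℓ * Real.log n) ∧
        TriangleBootstrap.NicelyActivates H C)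
    (hL2 : ∀ ℓ : ℕ, 4 ≤ ℓ → ℓ ≤ L →
      ∃ C : G.Subgraph, TriangleBootstrap.IsCycleOfLength C ℓ ∧
        ¬ ∃ H : G.Subgraph, H.Connected ∧
          (H.verts.ncard : ℝ) ∈ Set.Icc (ℓ : ℝ) ((K : ℝ) * ℓ * Real.log n) ∧
          TriangleBootstrap.NicelyActivates H C) :
    ¬ ∃ T : G.Subgraph, T.coe.IsTree ∧ (T.coe.diam : ℝ) ≤ (L : ℝ) / 100 ∧
      TriangleBootstrap.Activates T ⊤ := by
  classical
  rintro ⟨T, hT, hdiam, A, rfl, hA⟩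
  have hD : 100 * A.start.coe.diam ≤ L := by
    have : (100 : ℝ) * A.start.coe.diam ≤ L := by linarith
    exact_mod_cast this
  -- A tree on at least two vertices has positive diameter.
  have hL100 : 100 ≤ L := by
    have hV : Nontrivial V := Fintype.one_lt_card_iff_nontrivial.1 (by omega)
    have : Nontrivial A.start.verts := by
      rw [TriangleBootstrap.ActivationProcess.verts_start_eq_univ hA]
      exact Set.nontrivial_coe_sort.2 Set.nontrivial_univ
    have := SimpleGraph.connected_iff_diam_ne_zero.1 hT.connected
    omega
  -- Only the case `ℓ = 4` of (L2) is needed; its cycle also gives `n ≥ 3`, hence `ln n ≥ 1`.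
  obtain ⟨C, ⟨v, w, hw, hwl, rfl⟩, hC⟩ := hL2 4 le_rfl (by omega)
  have hlog : 1 ≤ Real.log n := by
    have h3 : 3 ≤ n := by
      have := (List.toFinset_card_of_nodup hw.support_nodup).symm.trans_le (Finset.card_le_univ _)
      rw [List.length_tail, SimpleGraph.Walk.length_support, hn] at this
      omega
    have h3' : (3 : ℝ) ≤ n := by exact_mod_cast h3
    rw [Real.le_log_iff_exp_le (by linarith)]
    linarith [Real.exp_one_lt_three]
  have h1 : (1 : ℝ) ≤ K₁ := by exact_mod_cast hK₁
  have h2 : 100 * (K₁ : ℝ) ≤ K := by exact_mod_cast hK.le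
  have h3 : (K : ℝ) ≤ K₂ := by exact_mod_cast hK₂.le
  have hfill := TriangleBootstrap.ActivationProcess.fills_of_isCycle hA hT hD hL100
    (κ := K₁ * Real.log n) (κ' := K₂ * Real.log n) (by nlinarith) (by nlinarith) (by
      intro x c hc hcL hf
      obtain ⟨H, hH, hnice, -, hle, hf'⟩ := hf.exists_nicelyActivates hc
      refine hf'.mono ?_
      -- A minimal filling above the lower threshold would fall in the range forbidden by (L1).
      by_contra hlt
      push Not at hlt
      refine hL1 c.length hc.three_le_length hcL
        ⟨H, _, ⟨x, c, hc, rfl, rfl⟩, hH, ⟨?_, ?_⟩, hnice⟩ <;> linarith) le_rfl v w hw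
    (fun e he => by
      have h' : (⊤ : G.Subgraph).edgeSet ⊆ A.final.edgeSet := SimpleGraph.Subgraph.edgeSet_mono hA
      exact h' (by simpa using w.edges_subset_edgeSet he)) (by omega)
  obtain ⟨H, hH, hnice, hge, hle, -⟩ := hfill.exists_nicelyActivates hw
  rw [hwl] at hge hle
  refine hC ⟨H, hH, ⟨hge, hle.trans ?_⟩, hnice⟩
  push_cast
  nlinarith [mul_nonneg (sub_nonneg.2 h2) (zero_le_one.trans hlog)]
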